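/- Let $(M,g,A)$ be a K\"ahler manifold: $M$ is a smooth manifold of dimension $n$, $g$ a smooth Riemannian metric with Levi-Civita connection $\nabla^g$, and $A$ a smooth $(1,1)$-tensor field with $A^2=-I$, $g(AX,AY)=g(X,Y)$ and $\nabla^g A=0$. For a smooth 1-form $\pi$ on $M$ let $\nabla^{\pi}$ be the quarter-symmetric metric $A$-connection with generator $\pi$, $$\nabla^{\pi}_XY=\nabla^g_XY-\pi(X)\,AY .$$ For a linear connection $\nabla$ put $R(X,Y)Z=\nabla_X\nabla_YZ-\nabla_Y\nabla_XZ-\nabla_{[X,Y]}Z$ and $\mathrm{Ric}(Y,Z)=\mathrm{Trace}\{X\mapsto R(X,Y)Z\}$; write $R^{1}$, $\mathrm{Ric}^{1}$ for those of $\nabla^{\pi}$ (the curvature tensor of the first kind and its Ricci tensor) and $R^g$, $\mathrm{Ric}^g$ for those of $\nabla^g$. Then the tensor $$H^{1}(X,Y)Z=R^{1}(X,Y)Z+\mathrm{Ric}^{1}(Y,AX)\,AZ$$ is independent of the generator $\pi$: for any two smooth 1-forms $\pi,\pi'$ the corresponding tensors coincide. Moreover, for every smooth 1-form $\pi$ and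 all smooth vector fields $X,Y,Z$ on $M$, $$R^{1}(X,Y)Z+\mathrm{Ric}^{1}(Y,AX)\,AZ=R^g(X,Y)Z+\mathrm{Ric}^g(Y,AX)\,AZ .$$ -/

import Mathlib

open Bundle
open scoped Manifold ContDiff

noncomputable section

namespace KahlerQSM

/-- Smooth vector fields on the `n`-dimensional smooth manifold `M`. -/
abbrev VField (n : ℕ) (M : Type*) [TopologicalSpace M]
    [ChartedSpace (EuclideanSpace ℝ (Fin n)) M] [IsManifold (𝓡 n) ∞ M] :=
  ContMDiffSection (𝓡 n) (EuclideanSpace ℝ (Fin n)) ∞ (fun x : M => TangentSpace (𝓡 n) x)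

/-- Smooth 1-forms on `M`: smooth sections of the cotangent bundle. -/
abbrev OneForm (n : ℕ) (M : Type*) [TopologicalSpace M]
    [ChartedSpace (EuclideanSpace ℝ (Fin n)) M] [IsManifold (𝓡 n) ∞ M] :=
  ContMDiffSection (𝓡 n) (EuclideanSpace ℝ (Fin n) →L[ℝ] ℝ) ∞
    (fun x : M => TangentSpace (𝓡 n) x →L[ℝ] ℝ)

/-- Smooth (1,1)-tensor fields on `M`: smooth sections of `End(TM)`. -/
abbrev EndField (n : ℕ) (M : Type*) [TopologicalSpace M]
    [ChartedSpace (EuclideanSpace ℝ (Fin n)) M] [IsManifold (𝓡 n) ∞ M] :=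
  ContMDiffSection (𝓡 n) (EuclideanSpace ℝ (Fin n) →L[ℝ] EuclideanSpace ℝ (Fin n)) ∞
    (fun x : M => TangentSpace (𝓡 n) x →L[ℝ] TangentSpace (𝓡 n) x)

/-- Smooth Riemannian metrics on `M`. -/
abbrev Metric (n : ℕ) (M : Type*) [TopologicalSpace M]
    [ChartedSpace (EuclideanSpace ℝ (Fin n)) M] [IsManifold (𝓡 n) ∞ M] :=
  ContMDiffRiemannianMetric (𝓡 n) ∞ (EuclideanSpace ℝ (Fin n))
    (fun x : M => TangentSpace (𝓡 n) x)

/-- Covariant derivatives on the tangent bundle of `M`; `nabla Y x v` is `∇_v Y`, for a tangent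
vector `v` at `x`. Smoothness is the class `nabla.ContMDiffCovariantDerivative ∞`. -/
abbrev Connection (n : ℕ) (M : Type*) [TopologicalSpace M]
    [ChartedSpace (EuclideanSpace ℝ (Fin n)) M] [IsManifold (𝓡 n) ∞ M] :=
  CovariantDerivative (𝓡 n) (EuclideanSpace ℝ (Fin n)) (fun x : M => TangentSpace (𝓡 n) x)

theorem clm_smooth {n : ℕ} {M : Type*} [TopologicalSpace M]
    [ChartedSpace (EuclideanSpace ℝ (Fin n)) M] {x : M} {F : Type*} [NormedAddCommGroup F] [NormedSpace ℝ F]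
    {L : M → EuclideanSpace ℝ (Fin n) →L[ℝ] F}
    (h : ∀ v, ContMDiffAt (𝓡 n) 𝓘(ℝ, F) ∞ (fun y => L y v) x) :
    ContMDiffAt (𝓡 n) 𝓘(ℝ, EuclideanSpace ℝ (Fin n) →L[ℝ] F) ∞ L x := by
  let b := EuclideanSpace.basisFun (Fin n) ℝ
  have h1 : L = fun y => ∑ i, (ContinuousLinearMap.smulRightL ℝ (EuclideanSpace ℝ (Fin n)) F
      (innerSL ℝ (b i))) (L y (b i)) := by
    ext1 y
    ext v
    conv_lhs => rw [← b.sum_repr' v]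
    simp
  rw [h1]
  have h2 : ContDiff ℝ ∞ (fun p : Fin n → F =>
      ∑ i, (ContinuousLinearMap.smulRightL ℝ (EuclideanSpace ℝ (Fin n)) F
      (innerSL ℝ (b i))) (p i)) := by fun_prop
  exact h2.contDiffAt.contMDiffAt.comp x (contMDiffAt_pi_space.2 fun i => h (b i))

variable {n : ℕ} {M : Type*} [TopologicalSpace M] [ChartedSpace (EuclideanSpace ℝ (Fin n)) M]
  [IsManifold (𝓡 n) ∞ M]

/-- The vector field `A X`. -/
def appEnd (A : EndField n M) (X : VField n M) : VField n M where
  toFun x := A x (X x)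
  contMDiff_toFun := A.contMDiff.clm_bundle_apply X.contMDiff

/-! ### The Levi-Civita connection -/

/-- The function `g(X,Y)`. -/
def ip (g : Metric n M) (X Y : Π x : M, TangentSpace (𝓡 n) x) : M → ℝ :=
  fun y => g.inner y (X y) (Y y)

theorem ip_comm (g : Metric n M) (X Y : Π x : M, TangentSpace (𝓡 n) x) : ip g X Y = ip g Y X :=
  funext fun y => g.symm y _ _

/-- The vector field `X` is differentiable at `x`. -/
abbrev DiffAt (X : Π x : M, TangentSpace (𝓡 n) x) (x : M) : Prop :=
  MDifferentiableAt (𝓡 n) (𝓡 n).tangent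
    (fun y => TotalSpace.mk' (EuclideanSpace ℝ (Fin n)) y (X y)) x

theorem ip_mdiff (g : Metric n M) {X Y : Π x : M, TangentSpace (𝓡 n) x} {x : M}
    (hX : DiffAt X x) (hY : DiffAt Y x) : MDifferentiableAt (𝓡 n) 𝓘(ℝ, ℝ) (ip g X Y) x := by
  have h := MDifferentiableAt.clm_bundle_apply₂ (F₁ := EuclideanSpace ℝ (Fin n))
    (F₂ := EuclideanSpace ℝ (Fin n)) (F₃ := ℝ) (E₃ := Bundle.Trivial M ℝ)
    ((g.contMDiff x).mdifferentiableAt (by simp)) hX hY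
  rw [mdifferentiableAt_totalSpace] at h
  exact h.2

/-- The Koszul expression, equal to `2 g(∇_X Y, W)` for the Levi-Civita connection `∇`. -/
def koszul (g : Metric n M) (X Y W : Π x : M, TangentSpace (𝓡 n) x) (x : M) : ℝ :=
  mvfderiv (𝓡 n) (ip g Y W) x (X x) + mvfderiv (𝓡 n) (ip g X W) x (Y x)
    - mvfderiv (𝓡 n) (ip g X Y) x (W x)
    + g.inner x (VectorField.mlieBracket (𝓡 n) X Y x) (W x)
    - g.inner x (VectorField.mlieBracket (𝓡 n) X W x) (Y x)
    - g.inner x (VectorField.mlieBracket (𝓡 n) Y W x) (X x)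

section koszul

variable (g : Metric n M) {f : M → ℝ} {X X' Y Y' W W' : Π x : M, TangentSpace (𝓡 n) x} {x : M}

theorem ip_smul_left : ip g (f • X) Y = f * ip g X Y := by ext1 y; simp [ip]
theorem ip_smul_right : ip g Y (f • X) = f * ip g Y X := by ext1 y; simp [ip]
theorem ip_add_left : ip g (X + X') Y = ip g X Y + ip g X' Y := by ext1 y; simp [ip]
theorem ip_add_right : ip g Y (X + X') = ip g Y X + ip g Y X' := by ext1 y; simp [ip]

theorem koszul_smul_left (hf : MDifferentiableAt (𝓡 n) 𝓘(ℝ, ℝ) f x)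
    (hX : DiffAt X x) (hY : DiffAt Y x) (hW : DiffAt W x) :
    koszul g (f • X) Y W x = f x * koszul g X Y W x := by
  simp only [koszul, ip_smul_left, mvfderiv_mul hf (ip_mdiff g hX hW),
    mvfderiv_mul hf (ip_mdiff g hX hY), VectorField.mlieBracket_smul_left hf hX]
  simp [ip]
  ring

theorem koszul_add_left (hX : DiffAt X x) (hX' : DiffAt X' x) (hY : DiffAt Y x)
    (hW : DiffAt W x) :
    koszul g (X + X') Y W x = koszul g X Y W x + koszul g X' Y W x := by
  simp only [koszul, ip_add_left, mvfderiv_add (ip_mdiff g hX hW) (ip_mdiff g hX' hW),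
    mvfderiv_add (ip_mdiff g hX hY) (ip_mdiff g hX' hY),
    VectorField.mlieBracket_add_left hX hX']
  simp
  ring

theorem koszul_smul_right (hf : MDifferentiableAt (𝓡 n) 𝓘(ℝ, ℝ) f x)
    (hX : DiffAt X x) (hY : DiffAt Y x) (hW : DiffAt W x) :
    koszul g X Y (f • W) x = f x * koszul g X Y W x := by
  simp only [koszul, ip_smul_right, mvfderiv_mul hf (ip_mdiff g hX hW),
    mvfderiv_mul hf (ip_mdiff g hY hW), VectorField.mlieBracket_smul_right hf hW]
  simp [ip]
  rw [g.symm x (W x), g.symm x (W x)]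
  ring

theorem koszul_add_right (hX : DiffAt X x) (hY : DiffAt Y x) (hW : DiffAt W x)
    (hW' : DiffAt W' x) :
    koszul g X Y (W + W') x = koszul g X Y W x + koszul g X Y W' x := by
  simp only [koszul, ip_add_right, mvfderiv_add (ip_mdiff g hX hW) (ip_mdiff g hX hW'),
    mvfderiv_add (ip_mdiff g hY hW) (ip_mdiff g hY hW'),
    VectorField.mlieBracket_add_right hW hW']
  simp
  ring

theorem koszul_smul_mid (hf : MDifferentiableAt (𝓡 n) 𝓘(ℝ, ℝ) f x)
    (hX : DiffAt X x) (hY : DiffAt Y x) (hW : DiffAt W x) :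
    koszul g X (f • Y) W x = f x * koszul g X Y W x
      + 2 * (mvfderiv (𝓡 n) f x (X x) * g.inner x (Y x) (W x)) := by
  simp only [koszul, ip_smul_left, ip_smul_right, mvfderiv_mul hf (ip_mdiff g hX hY),
    mvfderiv_mul hf (ip_mdiff g hY hW), VectorField.mlieBracket_smul_left hf hY,
    VectorField.mlieBracket_smul_right hf hY]
  simp [ip]
  rw [g.symm x (Y x) (X x)]
  ring

theorem koszul_add_mid (hX : DiffAt X x) (hY : DiffAt Y x) (hY' : DiffAt Y' x)
    (hW : DiffAt W x) :
    koszul g X (Y + Y') W x = koszul g X Y W x + koszul g X Y' W x := by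
  simp only [koszul, ip_add_left, ip_add_right,
    mvfderiv_add (ip_mdiff g hX hY) (ip_mdiff g hX hY'),
    mvfderiv_add (ip_mdiff g hY hW) (ip_mdiff g hY' hW),
    VectorField.mlieBracket_add_left hY hY', VectorField.mlieBracket_add_right hY hY']
  simp
  ring

theorem koszul_metric :
    koszul g X Y W x + koszul g X W Y x = 2 * mvfderiv (𝓡 n) (ip g Y W) x (X x) := by
  simp only [koszul]
  rw [ip_comm g W Y, VectorField.mlieBracket_swap_apply (V := W) (W := Y)]
  simp
  ring

theorem koszul_torsion :
    koszul g X Y W x - koszul g Y X W x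
      = 2 * g.inner x (VectorField.mlieBracket (𝓡 n) X Y x) (W x) := by
  simp only [koszul]
  rw [ip_comm g Y X, VectorField.mlieBracket_swap_apply (V := Y) (W := X)]
  simp
  ring

/-- The Koszul expression as a bilinear form in `X` and `W` at `x`. -/
def koszulForm (hY : DiffAt Y x) :
    TangentSpace (𝓡 n) x →L[ℝ] TangentSpace (𝓡 n) x →L[ℝ] ℝ :=
  TensorialAt.mkHom₂ (I := 𝓡 n) (F := EuclideanSpace ℝ (Fin n)) (F' := EuclideanSpace ℝ (Fin n))
    (fun X W => koszul g X Y W x) x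
    (fun _ hW => ⟨fun hf hX => koszul_smul_left g hf hX hY hW,
      fun hX hX' => koszul_add_left g hX hX' hY hW⟩)
    (fun _ hX => ⟨fun hf hW => koszul_smul_right g hf hX hY hW,
      fun hW hW' => koszul_add_right g hX hY hW hW'⟩)

theorem koszulForm_apply (hX : DiffAt X x) (hY : DiffAt Y x) (hW : DiffAt W x) :
    koszulForm g hY (X x) (W x) = koszul g X Y W x :=
  TensorialAt.mkHom₂_apply _ _ hX hW

theorem inner_inj (x : M) : Function.Injective (g.inner x) := by
  rw [injective_iff_map_eq_zero]
  intro v hv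
  by_contra h
  have := g.pos x v h
  rw [hv] at this
  simp at this

theorem inner_invertible (x : M) : (g.inner x).IsInvertible := by
  have hfd : FiniteDimensional ℝ (TangentSpace (𝓡 n) x) :=
    inferInstanceAs (FiniteDimensional ℝ (EuclideanSpace ℝ (Fin n)))
  have ht2 : T2Space (TangentSpace (𝓡 n) x) :=
    inferInstanceAs (T2Space (EuclideanSpace ℝ (Fin n)))
  have hfd' : FiniteDimensional ℝ (TangentSpace (𝓡 n) x →L[ℝ] ℝ) :=
    inferInstanceAs (FiniteDimensional ℝ (EuclideanSpace ℝ (Fin n) →L[ℝ] ℝ))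
  have hd : Module.finrank ℝ (TangentSpace (𝓡 n) x) =
      Module.finrank ℝ (TangentSpace (𝓡 n) x →L[ℝ] ℝ) := by
    rw [← (LinearMap.toContinuousLinearMap (𝕜 := ℝ) (E := TangentSpace (𝓡 n) x)
      (F' := ℝ)).finrank_eq]
    exact (Subspace.dual_finrank_eq (K := ℝ)).symm
  exact ⟨(LinearEquiv.ofInjectiveOfFinrankEq (g.inner x).toLinearMap (inner_inj g x)
    hd).toContinuousLinearEquiv, rfl⟩

theorem inner_ext {v w : TangentSpace (𝓡 n) x}
    (h : ∀ W : Π x : M, TangentSpace (𝓡 n) x, DiffAt W x →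
      g.inner x v (W x) = g.inner x w (W x)) : v = w := by
  apply inner_inj g x
  ext1 u
  simpa using h (FiberBundle.extend (EuclideanSpace ℝ (Fin n)) u)
    (FiberBundle.mdifferentiableAt_extend ..)

open Classical in
/-- The Levi-Civita derivative `∇_v Y`, through the Koszul formula. -/
def lcFun (Y : Π x : M, TangentSpace (𝓡 n) x) (x : M) :
    TangentSpace (𝓡 n) x →L[ℝ] TangentSpace (𝓡 n) x :=
  if hY : DiffAt Y x then (g.inner x).inverse ∘L ((1 / 2 : ℝ) • koszulForm g hY) else 0

theorem lcFun_koszul (hX : DiffAt X x) (hY : DiffAt Y x) (hW : DiffAt W x) :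
    2 * g.inner x (lcFun g Y x (X x)) (W x) = koszul g X Y W x := by
  rw [← koszulForm_apply g hX hY hW]
  simp [lcFun, dif_pos hY, (inner_invertible g x).self_apply_inverse]

/-- The Levi-Civita connection of `g`. -/
def leviCivita : Connection n M where
  toFun := lcFun g
  isCovariantDerivativeOnUniv :=
    { add := fun {Y Y' x} hY hY' _ => by
        ext1 v
        refine inner_ext g fun W hW => ?_
        have hX : DiffAt (FiberBundle.extend (EuclideanSpace ℝ (Fin n)) v) x :=
          FiberBundle.mdifferentiableAt_extend ..
        have h1 := lcFun_koszul g hX (mdifferentiableAt_add_section hY hY') hW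
        have h2 := lcFun_koszul g hX hY hW
        have h3 := lcFun_koszul g hX hY' hW
        rw [koszul_add_mid g hX hY hY' hW] at h1
        simp at h1 h2 h3 ⊢
        linarith
      leibniz := fun {Y f x} hY hf _ => by
        ext1 v
        refine inner_ext g fun W hW => ?_
        have hX : DiffAt (FiberBundle.extend (EuclideanSpace ℝ (Fin n)) v) x :=
          FiberBundle.mdifferentiableAt_extend ..
        have h1 := lcFun_koszul g hX (hf.smul_section hY) hW
        have h2 := lcFun_koszul g hX hY hW
        rw [koszul_smul_mid g hf hX hY hW] at h1
        simp at h1 h2 ⊢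
        linear_combination h1 / 2 - f x / 2 * h2 }

/-- `nabla` is a Levi-Civita connection of `g`: it is metric and torsion-free. -/
structure IsLeviCivita (g : Metric n M) (nabla : Connection n M) : Prop where
  metric :
    letI : RiemannianBundle (fun x : M => TangentSpace (𝓡 n) x) := ⟨g.toRiemannianMetric⟩
    haveI : IsContMDiffRiemannianBundle (𝓡 n) ∞ (EuclideanSpace ℝ (Fin n))
        (fun x : M => TangentSpace (𝓡 n) x) := inferInstance
    haveI : IsContMDiffRiemannianBundle (𝓡 n) 1 (EuclideanSpace ℝ (Fin n))
        (fun x : M => TangentSpace (𝓡 n) x) :=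
      IsContMDiffRiemannianBundle.of_le (n := ∞) (by norm_cast)
    nabla.IsMetricCompatible
  torsion_free : nabla.torsion = 0

theorem leviCivita_isLeviCivita : IsLeviCivita g (leviCivita g) := by
  constructor
  · letI : RiemannianBundle (fun x : M => TangentSpace (𝓡 n) x) := ⟨g.toRiemannianMetric⟩
    haveI : IsContMDiffRiemannianBundle (𝓡 n) ∞ (EuclideanSpace ℝ (Fin n))
        (fun x : M => TangentSpace (𝓡 n) x) := inferInstance
    haveI : IsContMDiffRiemannianBundle (𝓡 n) 1 (EuclideanSpace ℝ (Fin n))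
        (fun x : M => TangentSpace (𝓡 n) x) :=
      IsContMDiffRiemannianBundle.of_le (n := ∞) (by norm_cast)
    refine (CovariantDerivative.isMetricCompatible_iff (leviCivita g)).2 ?_
    intro x X Y W hX hY hW
    have h1 := lcFun_koszul g hX hY hW
    have h2 := lcFun_koszul g hX hW hY
    have h3 := koszul_metric g (X := X) (Y := Y) (W := W) (x := x)
    rw [g.symm] at h2
    change mvfderiv (𝓡 n) (ip g Y W) x (X x) = g.inner x (lcFun g Y x (X x)) (W x) +
      g.inner x (Y x) (lcFun g W x (X x))
    linarith
  · rw [CovariantDerivative.torsion_eq_zero_iff]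
    intro X Y x hX hY
    refine inner_ext g fun W hW => ?_
    have h1 := lcFun_koszul g hX hY hW
    have h2 := lcFun_koszul g hY hX hW
    have h3 := koszul_torsion g (X := X) (Y := Y) (W := W) (x := x)
    change g.inner x (lcFun g Y x (X x) - lcFun g X x (Y x)) (W x) = _
    simp
    linarith

/-- The vector field `X` is smooth at `x`. -/
abbrev SmoothAt (X : Π x : M, TangentSpace (𝓡 n) x) (x : M) : Prop :=
  ContMDiffAt (𝓡 n) (𝓡 n).tangent ∞
    (fun y => TotalSpace.mk' (EuclideanSpace ℝ (Fin n)) y (X y)) x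

theorem ip_smooth (hX : SmoothAt X x) (hY : SmoothAt Y x) :
    ContMDiffAt (𝓡 n) 𝓘(ℝ, ℝ) ∞ (ip g X Y) x := by
  have h := ContMDiffAt.clm_bundle_apply₂ (F₁ := EuclideanSpace ℝ (Fin n))
    (F₂ := EuclideanSpace ℝ (Fin n)) (F₃ := ℝ) (E₃ := Bundle.Trivial M ℝ)
    (g.contMDiff x) hX hY
  rw [contMDiffAt_totalSpace] at h
  exact h.2

theorem mvfderiv_smooth (hf : ContMDiffAt (𝓡 n) 𝓘(ℝ, ℝ) ∞ f x) (hX : SmoothAt X x) :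
    ContMDiffAt (𝓡 n) 𝓘(ℝ, ℝ) ∞ (fun y => mvfderiv (𝓡 n) f y (X y)) x := by
  have h1 := hf.mfderiv_const (m := ∞) (by simp)
  have h2 := ContMDiffAt.clm_apply_of_inCoordinates (b₁ := id) (b₂ := f) (m₀ := x)
    (F₁ := EuclideanSpace ℝ (Fin n)) (E₁ := fun x : M => TangentSpace (𝓡 n) x)
    (F₂ := ℝ) (E₂ := fun x : ℝ => TangentSpace 𝓘(ℝ, ℝ) x)
    (ϕ := fun y => mfderiv (𝓡 n) 𝓘(ℝ, ℝ) f y) (v := X) h1 hX hf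
  rw [contMDiffAt_totalSpace] at h2
  refine h2.2.congr_of_eventuallyEq (Filter.Eventually.of_forall fun y => ?_)
  simp
  rfl

theorem bracket_smooth (hX : SmoothAt X x) (hY : SmoothAt Y x) :
    SmoothAt (VectorField.mlieBracket (𝓡 n) X Y) x := by
  have : IsManifold (𝓡 n) (((⊤ : ℕ∞) : WithTop ℕ∞) + 1) M := by simpa using ‹IsManifold (𝓡 n) ∞ M›
  have : IsManifold (𝓡 n) (minSmoothness ℝ 2) M := by
    simpa using (inferInstance : IsManifold (𝓡 n) 2 M)
  exact ContMDiffAt.mlieBracket_vectorField (m := ⊤) (n := ⊤) hX hY (by simp)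

theorem koszul_smooth (hX : SmoothAt X x) (hY : SmoothAt Y x) (hW : SmoothAt W x) :
    ContMDiffAt (𝓡 n) 𝓘(ℝ, ℝ) ∞ (koszul g X Y W) x := by
  exact (((((mvfderiv_smooth (ip_smooth g hY hW) hX).add
    (mvfderiv_smooth (ip_smooth g hX hW) hY)).sub
    (mvfderiv_smooth (ip_smooth g hX hY) hW)).add
    (ip_smooth g (bracket_smooth hX hY) hW)).sub
    (ip_smooth g (bracket_smooth hX hW) hY)).sub
    (ip_smooth g (bracket_smooth hY hW) hX)

theorem lcFun_smooth (hY : ∀ y, SmoothAt Y y) (x : M) :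
    ContMDiffAt (𝓡 n)
      ((𝓡 n).prod 𝓘(ℝ, EuclideanSpace ℝ (Fin n) →L[ℝ] EuclideanSpace ℝ (Fin n))) ∞
      (fun y => TotalSpace.mk' (EuclideanSpace ℝ (Fin n) →L[ℝ] EuclideanSpace ℝ (Fin n))
      (E := fun x : M => TangentSpace (𝓡 n) x →L[ℝ] TangentSpace (𝓡 n) x) y (lcFun g Y y)) x := by
  have hg := g.contMDiff x
  rw [contMDiffAt_hom_bundle] at hg ⊢
  refine ⟨hg.1, ?_⟩
  replace hg := hg.2
  let e := trivializationAt (EuclideanSpace ℝ (Fin n)) (fun x : M => TangentSpace (𝓡 n) x) x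
  have hx : x ∈ e.baseSet := FiberBundle.mem_baseSet_trivializationAt' x
  -- constant sections in the trivialization
  let s (v : EuclideanSpace ℝ (Fin n)) (y : M) : TangentSpace (𝓡 n) y := e.symmL ℝ y v
  have hs (v) (y) (hy : y ∈ e.baseSet) : SmoothAt (s v) y := by
    refine (e.contMDiffAt_section_iff (IB := 𝓡 n) hy).2 ?_
    refine contMDiffAt_const (c := v) |>.congr_of_eventuallyEq ?_
    filter_upwards [e.open_baseSet.mem_nhds hy] with z hz
    simp [s, hz]
  set G : M → EuclideanSpace ℝ (Fin n) →L[ℝ] EuclideanSpace ℝ (Fin n) →L[ℝ] ℝ := fun y =>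
    ContinuousLinearMap.inCoordinates (EuclideanSpace ℝ (Fin n))
      (fun x : M => TangentSpace (𝓡 n) x) (EuclideanSpace ℝ (Fin n) →L[ℝ] ℝ)
      (fun x : M => TangentSpace (𝓡 n) x →L[ℝ] ℝ) x y x y (g.inner y) with hG
  have hgG : ContMDiffAt (𝓡 n) _ ∞ G x := hg
  set L : M → EuclideanSpace ℝ (Fin n) →L[ℝ] EuclideanSpace ℝ (Fin n) := fun y =>
    ContinuousLinearMap.inCoordinates (EuclideanSpace ℝ (Fin n))
      (fun x : M => TangentSpace (𝓡 n) x) (EuclideanSpace ℝ (Fin n))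
      (fun x : M => TangentSpace (𝓡 n) x) x y x y (lcFun g Y y) with hL
  change ContMDiffAt (𝓡 n) _ ∞ L x
  have hGa (y) (hy : y ∈ e.baseSet) (v w) : G y v w = g.inner y (s v y) (s w y) := by
    have := inCoordinates_apply_eq₂ (𝕜 := ℝ)
      (F₁ := EuclideanSpace ℝ (Fin n)) (F₂ := EuclideanSpace ℝ (Fin n)) (F₃ := ℝ)
      (E₁ := fun x : M => TangentSpace (𝓡 n) x) (E₂ := fun x : M => TangentSpace (𝓡 n) x)
      (E₃ := fun x : M => ℝ) (x₀ := x) (x := y) (ϕ := g.inner y) (v := v) (w := w) hy hy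
      (Set.mem_univ _)
    have hsv (v) : s v y = e.symm y v := e.symmL_apply hy v
    rw [hsv, hsv]
    simp at this
    exact this
  have hGL (y) (hy : y ∈ e.baseSet) (v w) :
      G y (L y v) w = koszul g (s v) Y (s w) y / 2 := by
    have h1 : s (L y v) y = lcFun g Y y (s v y) := by
      exact e.symmL_continuousLinearMapAt (R := ℝ) hy _
    rw [hGa y hy, h1, ← lcFun_koszul g ((hs v y hy).mdifferentiableAt (by simp))
      ((hY y).mdifferentiableAt (by simp)) ((hs w y hy).mdifferentiableAt (by simp))]
    ring
  have hGi (y) (hy : y ∈ e.baseSet) : (G y).IsInvertible := by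
    have hinj : Function.Injective (G y) := by
      rw [injective_iff_map_eq_zero]
      intro v hv
      by_contra h
      have h0 : s v y ≠ 0 := by
        intro h1
        apply h
        have h2 := e.continuousLinearMapAt_symmL (R := ℝ) hy v
        change e.continuousLinearMapAt ℝ y (s v y) = v at h2
        rw [← h2, h1, map_zero]
      have h2 := g.pos y (s v y) h0
      rw [← hGa y hy, hv] at h2
      simp at h2
    have hd : Module.finrank ℝ (EuclideanSpace ℝ (Fin n)) =
        Module.finrank ℝ (EuclideanSpace ℝ (Fin n) →L[ℝ] ℝ) := by
      rw [← (LinearMap.toContinuousLinearMap (𝕜 := ℝ) (E := EuclideanSpace ℝ (Fin n))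
        (F' := ℝ)).finrank_eq]
      exact (Subspace.dual_finrank_eq (K := ℝ)).symm
    exact ⟨(LinearEquiv.ofInjectiveOfFinrankEq (G y).toLinearMap hinj
      hd).toContinuousLinearEquiv, rfl⟩
  have hN : ContMDiffAt (𝓡 n)
      𝓘(ℝ, EuclideanSpace ℝ (Fin n) →L[ℝ] EuclideanSpace ℝ (Fin n) →L[ℝ] ℝ) ∞
      (fun y => (G y) ∘L (L y)) x := by
    refine clm_smooth fun v => clm_smooth fun w => ?_
    refine ((koszul_smooth g (hs v x hx) (hY x) (hs w x hx)).div_const 2).congr_of_eventuallyEq ?_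
    filter_upwards [e.open_baseSet.mem_nhds hx] with y hy
    exact hGL y hy v w
  have hI : ContMDiffAt (𝓡 n) _ ∞ (fun y => (G y).inverse) x :=
    (hGi x hx).contDiffAt_map_inverse.contMDiffAt.comp x hgG
  refine (hI.clm_comp hN).congr_of_eventuallyEq ?_
  filter_upwards [e.open_baseSet.mem_nhds hx] with y hy
  ext1 v
  simp [(hGi y hy).inverse_apply_self]

instance leviCivita_smooth : (leviCivita g).ContMDiffCovariantDerivative ∞ where
  contMDiff := ⟨by
    intro σ hσ
    have h2 : ∀ y, SmoothAt σ y := contMDiffOn_univ.1 (by simpa using hσ)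
    exact contMDiffOn_univ.2 fun x => lcFun_smooth g h2 x⟩

end koszul

/-! ### Kähler manifolds -/

/-- `(M, g, A)` is an almost Hermitian manifold. -/
structure IsAlmostHermitian (g : Metric n M) (A : EndField n M) : Prop where
  sq : ∀ (x : M) (v : TangentSpace (𝓡 n) x), A x (A x v) = -v
  compat : ∀ (x : M) (v w : TangentSpace (𝓡 n) x), g.inner x (A x v) (A x w) = g.inner x v w

/-- `(M, g, A)` is a Kähler manifold: it is almost Hermitian and, for the Levi-Civita connection,
`(∇_v A) Y = ∇_v (A Y) - A (∇_v Y)` vanishes for all tangent vectors `v` and fields `Y`. -/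
structure IsKahler (g : Metric n M) (A : EndField n M) : Prop where
  almostHermitian : IsAlmostHermitian g A
  parallel : ∀ (Y : VField n M) (x : M) (v : TangentSpace (𝓡 n) x),
    leviCivita g (appEnd A Y) x v - A x (leviCivita g Y x v) = 0

/-! ### Curvature and Ricci tensor of a connection -/

/-- The expression `∇_X ∇_Y Z - ∇_Y ∇_X Z - ∇_{[X,Y]} Z` at the point `x`, for vector fields that
need not be smooth. -/
def curvAux (nabla : Connection n M) (X Y Z : Π x : M, TangentSpace (𝓡 n) x) (x : M) :
    TangentSpace (𝓡 n) x :=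
  nabla (fun y => nabla Z y (Y y)) x (X x) - nabla (fun y => nabla Z y (X y)) x (Y x)
    - nabla Z x (VectorField.mlieBracket (𝓡 n) X Y x)

/-- The curvature `(R(X,Y)Z)(x)` of a connection, for smooth vector fields. -/
def curv (nabla : Connection n M) (X Y Z : VField n M) (x : M) : TangentSpace (𝓡 n) x :=
  curvAux nabla X Y Z x

theorem curvAux_tensorial (nabla : Connection n M) [hs : nabla.ContMDiffCovariantDerivative ∞]
    (Y Z : VField n M) (x : M) :
    TensorialAt (𝓡 n) (EuclideanSpace ℝ (Fin n)) (fun X => curvAux nabla X Y Z x) x := by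
  have hZ : MDifferentiable (𝓡 n)
      ((𝓡 n).prod 𝓘(ℝ, EuclideanSpace ℝ (Fin n) →L[ℝ] EuclideanSpace ℝ (Fin n)))
      (fun y => TotalSpace.mk' (EuclideanSpace ℝ (Fin n) →L[ℝ] EuclideanSpace ℝ (Fin n))
      (E := fun x : M => TangentSpace (𝓡 n) x →L[ℝ] TangentSpace (𝓡 n) x) y (nabla Z y)) := by
    have h := hs.contMDiff.contMDiff (σ := fun x => Z x) (by
      simpa using Z.contMDiff.contMDiffOn)
    exact (contMDiffOn_univ.1 h).mdifferentiable (by simp)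
  have hN : ∀ {X : Π x : M, TangentSpace (𝓡 n) x},
      MDifferentiableAt (𝓡 n) (𝓡 n).tangent
        (fun y => TotalSpace.mk' (EuclideanSpace ℝ (Fin n)) y (X y)) x →
      MDifferentiableAt (𝓡 n) (𝓡 n).tangent
        (fun y => TotalSpace.mk' (EuclideanSpace ℝ (Fin n)) y (nabla Z y (X y))) x :=
    fun hX => (hZ x).clm_bundle_apply hX
  have hc := nabla.isCovariantDerivativeOn (s := Set.univ)
  constructor
  · intro f X hf hX
    have h1 : (fun y => nabla Z y ((f • X) y)) = f • (fun y => nabla Z y (X y)) := by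
      ext1 y; simp
    have h2 := hc.leibniz (hN hX) hf
    have h3 := VectorField.mlieBracket_smul_left (W := Y) hf hX
    simp only [curvAux]
    rw [h1, h2, h3]
    simp
    module
  · intro X X' hX hX'
    have h1 : (fun y => nabla Z y ((X + X') y)) =
        (fun y => nabla Z y (X y)) + (fun y => nabla Z y (X' y)) := by
      ext1 y; simp
    have h2 := hc.add (hN hX) (hN hX')
    have h3 := VectorField.mlieBracket_add_left (W := Y) hX hX'
    simp only [curvAux]
    rw [h1, h2, h3]
    simp
    module

/-- The endomorphism `v ↦ R(v,Y)Z` of the tangent space at `x`. -/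
def curvOp (nabla : Connection n M) [nabla.ContMDiffCovariantDerivative ∞]
    (Y Z : VField n M) (x : M) : TangentSpace (𝓡 n) x →L[ℝ] TangentSpace (𝓡 n) x :=
  TensorialAt.mkHom _ x (curvAux_tensorial nabla Y Z x)

theorem curvOp_apply (nabla : Connection n M) [nabla.ContMDiffCovariantDerivative ∞]
    (X Y Z : VField n M) (x : M) : curvOp nabla Y Z x (X x) = curv nabla X Y Z x :=
  TensorialAt.mkHom_apply (curvAux_tensorial nabla Y Z x)
    (X.contMDiff.mdifferentiable (by simp) x)

/-- The Ricci tensor `Ric(Y,Z) = Trace {X ↦ R(X,Y)Z}` of a connection. -/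
def ric (nabla : Connection n M) [nabla.ContMDiffCovariantDerivative ∞]
    (Y Z : VField n M) (x : M) : ℝ :=
  LinearMap.trace ℝ (TangentSpace (𝓡 n) x) (curvOp nabla Y Z x).toLinearMap

/-! ### The quarter-symmetric connection -/

/-- The quarter-symmetric connection `∇_X Y - η(X) A Y` with generator `η`. -/
def qsConn (nabla : Connection n M) (A : EndField n M) (η : OneForm n M) : Connection n M where
  toFun Y x := nabla Y x - (η x).smulRight (A x (Y x))
  isCovariantDerivativeOnUniv :=
    { add := fun {Y Y' x} hY hY' _ => by
        ext1 v
        simp [nabla.isCovariantDerivativeOn.add hY hY']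
        module
      leibniz := fun {Y f x} hY hf _ => by
        ext1 v
        simp [nabla.isCovariantDerivativeOn.leibniz hY hf]
        module }

theorem smulRight_contMDiffAt (η : OneForm n M) (x₀ : M) (W : Π x : M, TangentSpace (𝓡 n) x)
    (hW : ContMDiffAt (𝓡 n) (𝓡 n).tangent ∞
      (fun y => TotalSpace.mk' (EuclideanSpace ℝ (Fin n)) y (W y)) x₀) :
    ContMDiffAt (𝓡 n)
      ((𝓡 n).prod 𝓘(ℝ, EuclideanSpace ℝ (Fin n) →L[ℝ] EuclideanSpace ℝ (Fin n))) ∞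
      (fun y => TotalSpace.mk' (EuclideanSpace ℝ (Fin n) →L[ℝ] EuclideanSpace ℝ (Fin n))
      (E := fun x : M => TangentSpace (𝓡 n) x →L[ℝ] TangentSpace (𝓡 n) x) y
        ((η y).smulRight (W y))) x₀ := by
  have h1 := (η.contMDiff x₀)
  rw [contMDiffAt_hom_bundle] at h1 ⊢
  rw [contMDiffAt_totalSpace] at hW
  refine ⟨h1.1, ?_⟩
  have h2 : ContDiff ℝ ∞
      (fun p : (EuclideanSpace ℝ (Fin n) →L[ℝ] ℝ) × EuclideanSpace ℝ (Fin n) =>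
        p.1.smulRight p.2) := contDiff_fst.smulRight contDiff_snd
  refine (h2.contDiffAt.contMDiffAt.comp x₀
    (h1.2.prodMk_space hW.2)).congr_of_eventuallyEq ?_
  have hb : (trivializationAt (EuclideanSpace ℝ (Fin n))
      (fun x : M => TangentSpace (𝓡 n) x) x₀).baseSet ∈ nhds x₀ :=
    (trivializationAt _ _ x₀).open_baseSet.mem_nhds
      (FiberBundle.mem_baseSet_trivializationAt' x₀)
  filter_upwards [hb] with y hy
  ext1 v
  simp [ContinuousLinearMap.inCoordinates]
  rw [Trivialization.coe_linearMapAt_of_mem _ hy]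

instance qsConn_smooth (nabla : Connection n M) [hs : nabla.ContMDiffCovariantDerivative ∞]
    (A : EndField n M) (η : OneForm n M) :
    (qsConn nabla A η).ContMDiffCovariantDerivative ∞ where
  contMDiff := ⟨by
    intro σ hσ
    have h1 := hs.contMDiff.contMDiff hσ
    have h2 : ContMDiff (𝓡 n) (𝓡 n).tangent ∞
      (fun y => TotalSpace.mk' (EuclideanSpace ℝ (Fin n)) y (A y (σ y))) :=
      A.contMDiff.clm_bundle_apply (contMDiffOn_univ.1 (by simpa using hσ))
    rw [contMDiffOn_univ] at h1 ⊢
    exact h1.sub_section fun x => smulRight_contMDiffAt η x _ (h2 x)⟩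

/-- The tensor `R(X,Y)Z + Ric(Y,AX) AZ` at `x`, formed with the curvature and the Ricci tensor of
the connection `nabla`. -/
def tensorH (nabla : Connection n M) [nabla.ContMDiffCovariantDerivative ∞] (A : EndField n M)
    (X Y Z : VField n M) (x : M) : TangentSpace (𝓡 n) x :=
  curv nabla X Y Z x + ric nabla Y (appEnd A X) x • A x (Z x)

end KahlerQSM

end

open KahlerQSM

namespace KahlerQSM

variable {n : ℕ} {M : Type*} [TopologicalSpace M] [ChartedSpace (EuclideanSpace ℝ (Fin n)) M]
  [IsManifold (𝓡 n) ∞ M]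

/-! Subtracting `η ⊗ A` from a connection `∇` with `∇A = 0` changes the curvature only by a multiple
of `A`: `R¹(X,Y)Z = R(X,Y)Z - dη(X,Y) AZ` (`curvAux_qsConn`). The correction `v ↦ dη(v,Y) AZ` has
rank at most one, so its trace is `dη(AZ,Y)` and `Ric¹(Y,Z) = Ric(Y,Z) - dη(AZ,Y)` (`ric_qsConn`).
Put `AX` in the second slot of `Ric¹`. Since `A² = -I`, this gives `Ric¹(Y,AX) = Ric(Y,AX) +
dη(X,Y)`, so the term `Ric¹(Y,AX) AZ` restores exactly the `dη(X,Y) AZ` that the curvature lost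
(`tensorH_qsConn`). The sum therefore equals the one formed with `∇`, in which `η` does not occur.
The argument is pointwise and is carried out for any smooth connection with `A` parallel; the
theorem is the Levi-Civita case. -/

/-! ### The exterior derivative of a 1-form as a tensor -/

theorem OneForm.mdifferentiableAt_apply (η : OneForm n M) {X : Π x : M, TangentSpace (𝓡 n) x}
    {x : M} (hX : DiffAt X x) : MDifferentiableAt (𝓡 n) 𝓘(ℝ, ℝ) (fun y => η y (X y)) x := by
  have h := MDifferentiableAt.clm_bundle_apply (F₁ := EuclideanSpace ℝ (Fin n))
    (F₂ := ℝ) (E₂ := Bundle.Trivial M ℝ) ((η.contMDiff x).mdifferentiableAt (by simp)) hX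
  rw [mdifferentiableAt_totalSpace] at h
  exact h.2

/-- The exterior derivative `X(η(Y)) - Y(η(X)) - η([X,Y])` of a 1-form at the point `x`, for vector
fields that need not be smooth. -/
noncomputable def extDer (η : OneForm n M) (X Y : Π x : M, TangentSpace (𝓡 n) x) (x : M) : ℝ :=
  mvfderiv (𝓡 n) (fun y => η y (Y y)) x (X x) - mvfderiv (𝓡 n) (fun y => η y (X y)) x (Y x)
    - η x (VectorField.mlieBracket (𝓡 n) X Y x)

/-- The term `(Yf) η(X)` from differentiating `f η(X)` cancels against the one from `[fX,Y] = f[X,Y]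
- (Yf)X`. Tensoriality in the first slot is all that the Ricci trace requires. -/
theorem extDer_tensorial (η : OneForm n M) (Y : Π x : M, TangentSpace (𝓡 n) x) (x : M) :
    TensorialAt (𝓡 n) (EuclideanSpace ℝ (Fin n)) (fun X => extDer η X Y x) x := by
  constructor
  · intro f X hf hX
    have h1 : (fun y => η y ((f • X) y)) = f * fun y => η y (X y) := by
      ext1 y; simp
    simp only [extDer]
    rw [h1, mvfderiv_mul hf (η.mdifferentiableAt_apply hX),
      VectorField.mlieBracket_smul_left (W := Y) hf hX]
    simp
    ring
  · intro X X' hX hX'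
    have h1 : (fun y => η y ((X + X') y)) = (fun y => η y (X y)) + fun y => η y (X' y) := by
      ext1 y; simp
    simp only [extDer]
    rw [h1, mvfderiv_add (η.mdifferentiableAt_apply hX) (η.mdifferentiableAt_apply hX'),
      VectorField.mlieBracket_add_left (W := Y) hX hX']
    simp
    ring

/-- The covector `v ↦ dη(v,Y)` at `x`. -/
noncomputable def extDerForm (η : OneForm n M) (Y : Π x : M, TangentSpace (𝓡 n) x) (x : M) :
    TangentSpace (𝓡 n) x →L[ℝ] ℝ :=
  TensorialAt.mkHom _ x (extDer_tensorial η Y x)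

theorem extDerForm_apply (η : OneForm n M) {X : Π x : M, TangentSpace (𝓡 n) x}
    (Y : Π x : M, TangentSpace (𝓡 n) x) {x : M} (hX : DiffAt X x) :
    extDerForm η Y x (X x) = extDer η X Y x :=
  TensorialAt.mkHom_apply (extDer_tensorial η Y x) hX

/-! ### Curvature of the quarter-symmetric connection -/

theorem diffAt_nabla (nabla : Connection n M) [hs : nabla.ContMDiffCovariantDerivative ∞]
    (Z : VField n M) {X : Π x : M, TangentSpace (𝓡 n) x} {x : M} (hX : DiffAt X x) :
    DiffAt (fun y => nabla Z y (X y)) x := by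
  have h := hs.contMDiff.contMDiff (σ := fun x => Z x) (by
    simpa using Z.contMDiff.contMDiffOn)
  exact MDifferentiableAt.clm_bundle_apply
    ((contMDiffOn_univ.1 h).mdifferentiable (by simp) x) hX

/-- Second covariant derivatives of the quarter-symmetric connection, for a parallel `A`. -/
theorem qsConn_qsConn (nabla : Connection n M) [nabla.ContMDiffCovariantDerivative ∞]
    (A : EndField n M) (η : OneForm n M) (Z : VField n M) {X : Π x : M, TangentSpace (𝓡 n) x}
    {x : M} (hX : DiffAt X x) (v : TangentSpace (𝓡 n) x) :
    qsConn nabla A η (fun y => qsConn nabla A η Z y (X y)) x v =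
      nabla (fun y => nabla Z y (X y)) x v
        - mvfderiv (𝓡 n) (fun y => η y (X y)) x v • A x (Z x)
        - η x (X x) • nabla (appEnd A Z) x v
        - η x v • A x (nabla Z x (X x)) + (η x v * η x (X x)) • A x (A x (Z x)) := by
  have hc := nabla.isCovariantDerivativeOn (s := Set.univ)
  have hA : DiffAt (appEnd A Z) x := (appEnd A Z).contMDiff.mdifferentiable (by simp) x
  have hη := (η.mdifferentiableAt_apply hX).neg
  -- The inner derivative is written as a sum with coefficient `-η(X)`, so that additivity and the
  -- Leibniz rule of `nabla` apply to it.
  have h1 : (fun y => qsConn nabla A η Z y (X y)) =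
      (fun y => nabla Z y (X y)) + (-fun y => η y (X y)) • fun y => appEnd A Z y := by
    ext1 y
    change nabla Z y (X y) - η y (X y) • A y (Z y) =
      nabla Z y (X y) + (-η y (X y)) • A y (Z y)
    module
  have h2 : mvfderiv (𝓡 n) (-fun y => η y (X y)) x v
      = -mvfderiv (𝓡 n) (fun y => η y (X y)) x v := by
    simp [mvfderiv_neg]
  have h3 := hc.add (diffAt_nabla nabla Z hX) (hη.smul_section hA)
  have h4 := hc.leibniz hA hη
  -- Only the outer derivative is unfolded here; its `η(v) A` part, acting on the inner `-η(X) AZ`,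
  -- produces the `A²` term.
  change nabla (fun y => qsConn nabla A η Z y (X y)) x v
    - η x v • A x (nabla Z x (X x) - η x (X x) • A x (Z x)) = _
  have h5 : nabla ((-fun y => η y (X y)) • fun y => appEnd A Z y) x v
      = (-η x (X x)) • nabla (appEnd A Z) x v
        + (-mvfderiv (𝓡 n) (fun y => η y (X y)) x v) • A x (Z x) := by
    rw [h4, ← h2]
    rfl
  rw [h1, h3, add_apply, h5, map_sub, map_smul]
  module

/-- Once `∇_v(AZ) = A∇_v Z`, the cross terms `η(X) A∇_Y Z + η(Y) A∇_X Z` and the term `η(X)η(Y) A²Z`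
are symmetric in `X, Y` and vanish on antisymmetrizing. The derivatives of `η(X)` and `η(Y)`,
together with the bracket term, assemble into `dη(X,Y)`. -/
theorem curvAux_qsConn (nabla : Connection n M) [nabla.ContMDiffCovariantDerivative ∞]
    (A : EndField n M) (η : OneForm n M)
    (hA : ∀ (Y : VField n M) (x : M) (v : TangentSpace (𝓡 n) x),
      nabla (appEnd A Y) x v - A x (nabla Y x v) = 0)
    (Z : VField n M) {X Y : Π x : M, TangentSpace (𝓡 n) x} {x : M}
    (hX : DiffAt X x) (hY : DiffAt Y x) :
    curvAux (qsConn nabla A η) X Y Z x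
      = curvAux nabla X Y Z x - extDer η X Y x • A x (Z x) := by
  have h (v) := sub_eq_zero.1 (hA Z x v)
  have h1 (v) : qsConn nabla A η Z x v = nabla Z x v - η x v • A x (Z x) := rfl
  simp only [curvAux, extDer]
  rw [qsConn_qsConn nabla A η Z hX, qsConn_qsConn nabla A η Z hY, h1, h, h]
  module

/-- The curvature identity recast as an equality of endomorphisms, the form in which a trace can be
taken. -/
theorem curvOp_qsConn (nabla : Connection n M) [nabla.ContMDiffCovariantDerivative ∞]
    (A : EndField n M) (η : OneForm n M)
    (hA : ∀ (Y : VField n M) (x : M) (v : TangentSpace (𝓡 n) x),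
      nabla (appEnd A Y) x v - A x (nabla Y x v) = 0)
    (Y Z : VField n M) (x : M) :
    curvOp (qsConn nabla A η) Y Z x
      = curvOp nabla Y Z x - (extDerForm η Y x).smulRight (A x (Z x)) := by
  ext1 v
  -- The extension of `v` is used only through its differentiability at `x`, which is why the
  -- preceding lemmas avoid assuming `X` smooth.
  let X : Π y : M, TangentSpace (𝓡 n) y := FiberBundle.extend (EuclideanSpace ℝ (Fin n)) v
  have hX : DiffAt X x := FiberBundle.mdifferentiableAt_extend ..
  have hY : DiffAt Y x := Y.contMDiff.mdifferentiable (by simp) x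
  have hv : X x = v := by simp [X]
  rw [← hv]
  have h1 : curvOp (qsConn nabla A η) Y Z x (X x) = curvAux (qsConn nabla A η) X Y Z x :=
    TensorialAt.mkHom_apply (curvAux_tensorial (qsConn nabla A η) Y Z x) hX
  have h2 : curvOp nabla Y Z x (X x) = curvAux nabla X Y Z x :=
    TensorialAt.mkHom_apply (curvAux_tensorial nabla Y Z x) hX
  rw [h1, curvAux_qsConn nabla A η hA Z hX hY, sub_apply, h2,
    ContinuousLinearMap.smulRight_apply, extDerForm_apply η Y hX]

/-! ### Ricci tensor and cancellation of the generator -/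

theorem ric_qsConn (nabla : Connection n M) [nabla.ContMDiffCovariantDerivative ∞]
    (A : EndField n M) (η : OneForm n M)
    (hA : ∀ (Y : VField n M) (x : M) (v : TangentSpace (𝓡 n) x),
      nabla (appEnd A Y) x v - A x (nabla Y x v) = 0)
    (Y Z : VField n M) (x : M) :
    ric (qsConn nabla A η) Y Z x = ric nabla Y Z x - extDerForm η Y x (A x (Z x)) := by
  have hfd : FiniteDimensional ℝ (TangentSpace (𝓡 n) x) :=
    inferInstanceAs (FiniteDimensional ℝ (EuclideanSpace ℝ (Fin n)))
  simp only [ric]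
  rw [curvOp_qsConn nabla A η hA, ContinuousLinearMap.toLinearMap_sub, map_sub]
  congr 1
  -- The trace of `v ↦ ω(v) w` is `ω(w)`, here with `ω = dη(·,Y)` and `w = AZ`.
  exact LinearMap.trace_smulRight _ _

theorem tensorH_qsConn (nabla : Connection n M) [nabla.ContMDiffCovariantDerivative ∞]
    (A : EndField n M) (η : OneForm n M)
    (hsq : ∀ (x : M) (v : TangentSpace (𝓡 n) x), A x (A x v) = -v)
    (hA : ∀ (Y : VField n M) (x : M) (v : TangentSpace (𝓡 n) x),
      nabla (appEnd A Y) x v - A x (nabla Y x v) = 0)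
    (X Y Z : VField n M) (x : M) :
    tensorH (qsConn nabla A η) A X Y Z x = tensorH nabla A X Y Z x := by
  have hX : DiffAt X x := X.contMDiff.mdifferentiable (by simp) x
  have hY : DiffAt Y x := Y.contMDiff.mdifferentiable (by simp) x
  -- This sign turns the Ricci correction `-dη(A(AX),Y)` into `+dη(X,Y)`, opposite to the curvature
  -- correction.
  have h1 : A x (appEnd A X x) = -X x := hsq x (X x)
  simp only [tensorH, curv]
  rw [curvAux_qsConn nabla A η hA Z hX hY, ric_qsConn nabla A η hA, h1, map_neg,
    extDerForm_apply η Y hX]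
  module

end KahlerQSM

theorem mainTheorem8 {n : ℕ} {M : Type*} [TopologicalSpace M] [T2Space M]
    [ChartedSpace (EuclideanSpace ℝ (Fin n)) M] [IsManifold (𝓡 n) ∞ M]
    (g : KahlerQSM.Metric n M) (A : EndField n M) (hK : IsKahler g A) :
    (∀ (η η' : OneForm n M) (X Y Z : VField n M) (x : M),
      tensorH (qsConn (leviCivita g) A η) A X Y Z x
        = tensorH (qsConn (leviCivita g) A η') A X Y Z x) ∧
    (∀ (η : OneForm n M) (X Y Z : VField n M) (x : M),
      tensorH (qsConn (leviCivita g) A η) A X Y Z x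
        = curv (leviCivita g) X Y Z x
          + ric (leviCivita g) Y (appEnd A X) x • A x (Z x)) := by
  have h (η : OneForm n M) (X Y Z : VField n M) (x : M) :=
    tensorH_qsConn (leviCivita g) A η hK.almostHermitian.sq hK.parallel X Y Z x
  -- Both generators give the Levi-Civita tensor, whence independence; the second claim is `h`
  -- itself with `tensorH` unfolded on the right.
  exact ⟨fun η η' X Y Z x => (h η X Y Z x).trans (h η' X Y Z x).symm, h⟩
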